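/- Let $N\ge 1$ and let $H(p,q)=\frac{p^2}{2\mathsf m}+U(q)$, $p,q\in\mathbb R^{3N}$, with mass $\mathsf m>0$ and a measurable potential $U\ge 0$. Let $b>0$ (for instance $b=\frac1{kT}$) be such that $\int e^{-bH}\,dp\,dq$ and $\int He^{-bH}\,dp\,dq$ are finite. For a positive integer $L$ define $\Delta\omega$ and the total energy $\mathcal E$ by $$\frac1{\Delta\omega}\int e^{-bH}\,dp\,dq=L,\qquad \mathcal E=\frac1{\Delta\omega}\int He^{-bH}\,dp\,dq .$$ Split $\{H\le \mathcal E\}$ by $0=E_0<E_1<\dots<E_s=\mathcal E$ into energy shells $E_l\le H\le E_{l+1}$, $l=0,\dots,s-1$, of phase volume $\Delta\omega$ each (the last shell, cut off at $\mathcal E$, may have smaller volume), and let $\varepsilon_l$ be the mean value of $H$ over the $l$-th shell. Consider the set $\Omega_L\subset(\mathbb R^{6N})^L$ of all $(\xi_1,\dots,\xi_L)$ for which there are shell numbers $l_1,\dots,l_L$ (an ordered sample with return) such that $\xi_i$ lies in the shell $l_i$ for each $i$ and $\sum_{i=1}^L\varepsilon_{l_i}\le\mathcal E$. Let $\mathcal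 P$ be Lebesgue measure on $\Omega_L$ divided by the volume of $\Omega_L$, and let $\rho_{E_l}$ be the fraction of the $L$ points $\xi_i$ that lie in the shell $E_l\le H\le E_{l+1}$. Then for every integer $m$ there is $L_0$, depending only on $H$, $b$ and $m$, such that for all $L\ge L_0$, every such splitting and every $l=0,\dots,s-1$, the volume of $\Omega_L$ is positive and finite, and $$\mathcal P\left(\left|L\rho_{E_l}-\frac1{\Delta\omega}\int_{E_l\le H\le E_{l+1}}e^{-bH}\,dp\,dq\right|\ge\sqrt{L\ln L}\right)\le L^{-m}.$$ -/

import Mathlib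

open MeasureTheory

noncomputable section

namespace GibbsShells

/-- The phase space of `N` particles: pairs `(p, q)` with `p, q ∈ ℝ^{3N}`, with Lebesgue measure. -/
abbrev PhaseSpace (N : ℕ) : Type :=
  EuclideanSpace ℝ (Fin (3 * N)) × EuclideanSpace ℝ (Fin (3 * N))

/-- The Hamiltonian `H(p, q) = p² / (2 mass) + U(q)`. -/
def hamiltonian {N : ℕ} (mass : ℝ) (U : EuclideanSpace ℝ (Fin (3 * N)) → ℝ)
    (x : PhaseSpace N) : ℝ :=
  ‖x.1‖ ^ 2 / (2 * mass) + U x.2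

/-- The energy shell `E_l ≤ H ≤ E_{l+1}`. -/
def shell {N s : ℕ} (H : PhaseSpace N → ℝ) (E : Fin (s + 1) → ℝ) (l : Fin s) :
    Set (PhaseSpace N) :=
  {x | E l.castSucc ≤ H x ∧ H x ≤ E l.succ}

/-- `0 = E_0 < E_1 < ⋯ < E_s = Etot` cuts `{H ≤ Etot}` into shells of phase volume `Δω`; the last
shell, which is cut off at `Etot`, may be smaller. -/
structure IsShellPartition {N s : ℕ} (H : PhaseSpace N → ℝ) (Δω Etot : ℝ)
    (E : Fin (s + 1) → ℝ) : Prop where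
  strictMono : StrictMono E
  first : E 0 = 0
  last : E (Fin.last s) = Etot
  volume_eq : ∀ l : Fin s, (l : ℕ) + 1 < s → volume (shell H E l) = ENNReal.ofReal Δω
  volume_le : ∀ l : Fin s, volume (shell H E l) ≤ ENNReal.ofReal Δω

/-- The mean energy of a shell: the integral of `H` over the shell divided by its phase volume. -/
def shellEnergy {N s : ℕ} (H : PhaseSpace N → ℝ) (E : Fin (s + 1) → ℝ) (l : Fin s) : ℝ :=
  ⨍ x in shell H E l, H x

/-- The part of `(ℝ^{6N})^L` consisting of the `L`-tuples of phase points whose coordinates lie in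
the shells of an ordered sample with return `τ` (of size `L`, from the `s` shells) such that the
mean energies of the sampled shells have sum at most `Etot`. -/
def admissible {N s : ℕ} (L : ℕ) (H : PhaseSpace N → ℝ) (Etot : ℝ) (E : Fin (s + 1) → ℝ) :
    Set (Fin L → PhaseSpace N) :=
  {ξ | ∃ τ : Fin L → Fin s,
    (∀ i, ξ i ∈ shell H E (τ i)) ∧ ∑ i, shellEnergy H E (τ i) ≤ Etot}

/-- Lebesgue measure on the admissible part of `(ℝ^{6N})^L`, divided by the volume of that part. -/
def phaseProb {N s : ℕ} (L : ℕ) (H : PhaseSpace N → ℝ) (Etot : ℝ) (E : Fin (s + 1) → ℝ) :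
    Measure (Fin L → PhaseSpace N) :=
  ProbabilityTheory.cond volume (admissible L H Etot E)

/-- The fraction of the `L` phase points `ξ_1, …, ξ_L` that lie in the shell `l`. -/
def shellDensity {N s L : ℕ} (H : PhaseSpace N → ℝ) (E : Fin (s + 1) → ℝ) (l : Fin s)
    (ξ : Fin L → PhaseSpace N) : ℝ :=
  ({i : Fin L | ξ i ∈ shell H E l}.ncard : ℝ) / L

end GibbsShells

end

/-! Every shell has volume at most `Δω` and `exp (-b * H) ≤ 1`, so the Gibbs value of an occupation
number lies in `[0, 1]`. A deviation of at least `√(L ln L) > 1` is therefore an excess: the shell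
is hit at least `K = ⌈√(L ln L)⌉` times. It suffices that this has probability at most `C ^ K / K!`
with `C` independent of `L`, since `K ^ 2 ≥ L` and the factorial beats every power.

In units of `Δω ^ L` the volume of the admissible set is a weighted count `A L X` (`totalWeight`) of
samples with energy at most `X = L * h`, where `h` is the Gibbs mean energy. Removing `K` visits to
the shell bounds the `K`-th factorial moment by `L ^ K * A (L - K) X` (`sum_descFactorial_le`).
Conversely, shells of energy at most `h₁` have total weight at least `c * L`, and appending `K` of
them gives `A L X ≥ (c * L) ^ K * A (L - K) (X - K * h₁)` (`pow_mul_totalWeight_le`). What remains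
is to compare `A n X` with `A n (X - K * h₁)`.

This is done in steps of `h' - h₁`, each costing a bounded factor (`totalWeight_add_le`). Choose
`h'` so that `{H ≤ h'}` has tiny volume. By a Chernoff bound, samples with half their energies below
`h'` are negligible (`sum_sampleWeight_low_le`). By Markov, any other sample has a quarter of its
energies in `(h', D]`; exchanging one of these for an energy at most `h₁` lowers the total by at
least `h' - h₁` (`sum_sampleWeight_mid_le`). Such `h₁ < h'` exist because energy levels are null
sets (`exists_sublevel_small`). -/

namespace GibbsShells

open Filter
open scoped Finset Topology ENNReal

/-! ### Weighted counting of samples under an energy bound -/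

section Sampling

variable {ι : Type*} {w ε : ι → ℝ}

/-- The weight `∏ w (τ i)` of a sample `τ`, set to zero when its energy `∑ ε (τ i)` exceeds `X`. -/
noncomputable def sampleWeight (w ε : ι → ℝ) {n : ℕ} (X : ℝ) (τ : Fin n → ι) : ℝ :=
  if ∑ i, ε (τ i) ≤ X then ∏ i, w (τ i) else 0

lemma sampleWeight_nonneg (hw : ∀ j, 0 ≤ w j) {n : ℕ} (X : ℝ) (τ : Fin n → ι) :
    0 ≤ sampleWeight w ε X τ := by
  unfold sampleWeight
  split_ifs
  · exact Finset.prod_nonneg fun i _ => hw _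
  · exact le_rfl

lemma sampleWeight_mono (hw : ∀ j, 0 ≤ w j) {n : ℕ} {X Y : ℝ} (hXY : X ≤ Y) (τ : Fin n → ι) :
    sampleWeight w ε X τ ≤ sampleWeight w ε Y τ := by
  unfold sampleWeight
  split_ifs with h₁ h₂
  · exact le_rfl
  · exact absurd (h₁.trans hXY) h₂
  · exact Finset.prod_nonneg fun i _ => hw _
  · exact le_rfl

lemma sampleWeight_insertNth {n : ℕ} (i : Fin (n + 1)) (X : ℝ) (j : ι) (σ : Fin n → ι) :
    sampleWeight w ε X (i.insertNth j σ : Fin (n + 1) → ι) =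
      w j * sampleWeight w ε (X - ε j) σ := by
  unfold sampleWeight
  simp only [Fin.sum_univ_succAbove _ i, Fin.prod_univ_succAbove _ i, Fin.insertNth_apply_same,
    Fin.insertNth_apply_succAbove, mul_ite, mul_zero, le_sub_iff_add_le']

variable [Fintype ι]

/-- The total weight of the ordered samples of size `n` with energy at most `X`. -/
noncomputable def totalWeight (w ε : ι → ℝ) (n : ℕ) (X : ℝ) : ℝ :=
  ∑ τ : Fin n → ι, sampleWeight w ε X τ

lemma totalWeight_nonneg (hw : ∀ j, 0 ≤ w j) (n : ℕ) (X : ℝ) : 0 ≤ totalWeight w ε n X :=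
  Finset.sum_nonneg fun τ _ => sampleWeight_nonneg hw X τ

lemma totalWeight_mono (hw : ∀ j, 0 ≤ w j) (n : ℕ) {X Y : ℝ} (hXY : X ≤ Y) :
    totalWeight w ε n X ≤ totalWeight w ε n Y :=
  Finset.sum_le_sum fun τ _ => sampleWeight_mono hw hXY τ

lemma sum_insertNth {n : ℕ} (i : Fin (n + 1)) (g : (Fin (n + 1) → ι) → ℝ) :
    ∑ τ, g τ = ∑ j, ∑ σ : Fin n → ι, g (i.insertNth j σ) := by
  rw [← Fintype.sum_prod_type']
  exact ((Fin.insertNthEquiv (fun _ => ι) i).sum_comp g).symm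

lemma totalWeight_succ (n : ℕ) (X : ℝ) :
    totalWeight w ε (n + 1) X = ∑ j, w j * totalWeight w ε n (X - ε j) := by
  simp only [totalWeight, sum_insertNth 0, sampleWeight_insertNth, Finset.mul_sum]

/-- Double counting: the factor `#{i | P (τ i)}` marks one coordinate satisfying `P`. Removing it
leaves a shorter sample with one marked value fewer and a reduced energy bound, and all `n + 1`
positions contribute equally. -/
lemma sum_card_mul (n : ℕ) (P : ι → Prop) [DecidablePred P] (X : ℝ)
    (g : ℕ → ℝ) :
    ∑ τ : Fin (n + 1) → ι, (#{i | P (τ i)} : ℝ) * g #{i | P (τ i)} * sampleWeight w ε X τ =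
      (n + 1) * ∑ j with P j, w j *
        ∑ σ : Fin n → ι, g (#{i | P (σ i)} + 1) * sampleWeight w ε (X - ε j) σ := by
  have key : ∀ i : Fin (n + 1),
      ∑ τ : Fin (n + 1) → ι,
        (if P (τ i) then g #{i | P (τ i)} * sampleWeight w ε X τ else 0) =
      ∑ j with P j, w j *
        ∑ σ : Fin n → ι, g (#{i | P (σ i)} + 1) * sampleWeight w ε (X - ε j) σ := by
    intro i
    rw [sum_insertNth i, Finset.sum_filter]
    refine Finset.sum_congr rfl fun j _ => ?_
    by_cases hj : P j
    · simp only [Fin.insertNth_apply_same, hj, if_true, Finset.mul_sum]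
      refine Finset.sum_congr rfl fun σ _ => ?_
      have hcard : #{k | P ((i.insertNth j σ : Fin (n + 1) → ι) k)} = #{k | P (σ k)} + 1 := by
        simp only [Finset.card_filter, Fin.sum_univ_succAbove _ i, Fin.insertNth_apply_same,
          Fin.insertNth_apply_succAbove, hj, if_true]
        ring
      rw [hcard, sampleWeight_insertNth]
      ring
    · simp [hj]
  have : ∀ τ : Fin (n + 1) → ι,
      (#{i | P (τ i)} : ℝ) * g #{i | P (τ i)} * sampleWeight w ε X τ =
      ∑ i, (if P (τ i) then g #{i | P (τ i)} * sampleWeight w ε X τ else 0) := by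
    intro τ
    rw [← Finset.sum_filter, Finset.sum_const, nsmul_eq_mul, mul_assoc]
  simp only [this]
  rw [Finset.sum_comm]
  simp only [key, Finset.sum_const, Finset.card_univ, Fintype.card_fin, nsmul_eq_mul]
  push_cast
  ring

/-- The factorial moments of the number of times that `l` is sampled. -/
lemma sum_descFactorial_le [DecidableEq ι] (hw : ∀ j, 0 ≤ w j) (hw1 : ∀ j, w j ≤ 1)
    (hε : ∀ j, 0 ≤ ε j) (l : ι) (n k : ℕ) (X : ℝ) :
    ∑ τ : Fin (n + k) → ι,
        ((#{i | τ i = l}).descFactorial k : ℝ) * sampleWeight w ε X τ ≤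
      ((n + k : ℕ) : ℝ) ^ k * totalWeight w ε n X := by
  induction k generalizing X with
  | zero => simp [totalWeight]
  | succ k ih =>
    -- The falling factorial splits as `c * (c - 1).descFactorial k`, the shape to which
    -- `sum_card_mul` applies; truncated subtraction is harmless because at `c = 0` both sides
    -- vanish.
    have h1 : ∀ τ : Fin (n + k + 1) → ι,
        ((#{i | τ i = l}).descFactorial (k + 1) : ℝ) * sampleWeight w ε X τ =
        (#{i | τ i = l} : ℝ) * (fun c : ℕ => ((c - 1).descFactorial k : ℝ)) #{i | τ i = l}
          * sampleWeight w ε X τ := by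
      intro τ
      congr 1
      rcases Nat.eq_zero_or_pos #{i | τ i = l} with h | h
      · simp [h]
      · obtain ⟨c, hc⟩ := Nat.exists_eq_add_of_le' h
        rw [hc, Nat.succ_eq_add_one, zero_add, Nat.succ_descFactorial_succ]
        simp only [Nat.add_sub_cancel]
        push_cast
        ring
    have h2 : ∑ τ : Fin (n + k + 1) → ι,
          ((#{i | τ i = l}).descFactorial (k + 1) : ℝ) * sampleWeight w ε X τ =
        ((n + k : ℕ) + 1 : ℝ) * (w l * ∑ σ : Fin (n + k) → ι,
          ((#{i | σ i = l}).descFactorial k : ℝ) * sampleWeight w ε (X - ε l) σ) := by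
      have h3 := sum_card_mul (w := w) (ε := ε) (n + k) (fun j => j = l) X
        (fun c : ℕ => ((c - 1).descFactorial k : ℝ))
      simp only [Nat.add_sub_cancel, Finset.filter_eq', Finset.mem_univ, if_true,
        Finset.sum_singleton] at h3
      rw [← h3]
      exact Finset.sum_congr rfl fun τ _ => h1 τ
    calc _ = _ := h2
      _ ≤ ((n + k : ℕ) + 1 : ℝ) * (1 * (((n + k : ℕ) : ℝ) ^ k * totalWeight w ε n X)) := by
        gcongr
        · exact Finset.sum_nonneg fun σ _ =>
            mul_nonneg (Nat.cast_nonneg _) (sampleWeight_nonneg hw _ _)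
        · exact hw1 l
        · refine (ih (X - ε l)).trans ?_
          gcongr
          exact totalWeight_mono hw n (by linarith [hε l])
      _ ≤ ((n + (k + 1) : ℕ) : ℝ) ^ (k + 1) * totalWeight w ε n X := by
        rw [one_mul, pow_succ']
        have := totalWeight_nonneg (ε := ε) hw n X
        push_cast
        rw [← add_assoc, mul_assoc]
        exact mul_le_mul_of_nonneg_left (mul_le_mul_of_nonneg_right
          (pow_le_pow_left₀ (by positivity) (by linarith) k) this) (by positivity)

/-- Markov's inequality for the factorial moment: a count of at least `k` has falling factorial at
least `k!`. -/
lemma sum_sampleWeight_card_ge [DecidableEq ι] (hw : ∀ j, 0 ≤ w j) (hw1 : ∀ j, w j ≤ 1)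
    (hε : ∀ j, 0 ≤ ε j) (l : ι) (n k : ℕ) (X : ℝ) :
    ∑ τ : Fin (n + k) → ι with k ≤ #{i | τ i = l}, sampleWeight w ε X τ ≤
      ((n + k : ℕ) : ℝ) ^ k / k.factorial * totalWeight w ε n X := by
  have hk : (0 : ℝ) < k.factorial := by positivity
  rw [div_mul_eq_mul_div, le_div_iff₀ hk]
  refine le_trans ?_ (sum_descFactorial_le hw hw1 hε l n k X)
  rw [Finset.sum_mul, Finset.sum_filter]
  refine Finset.sum_le_sum fun τ _ => ?_
  have h0 := sampleWeight_nonneg (ε := ε) hw X τ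
  split_ifs with h
  · rw [mul_comm]
    gcongr
    rw [← Nat.descFactorial_self]
    exact Nat.descFactorial_le k h
  · positivity

/-- Append `k` coordinates of energy at most `h` to a sample: each consumes at most `h` of the
energy bound and contributes weight at least `a`. -/
lemma pow_mul_totalWeight_le (hw : ∀ j, 0 ≤ w j) {a h : ℝ} (ha : 0 ≤ a)
    (hah : a ≤ ∑ j with ε j ≤ h, w j) (n k : ℕ) (X : ℝ) :
    a ^ k * totalWeight w ε n (X - k * h) ≤ totalWeight w ε (n + k) X := by
  induction k generalizing X with
  | zero => simp
  | succ k ih =>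
    rw [← add_assoc, totalWeight_succ]
    calc a ^ (k + 1) * totalWeight w ε n (X - (k + 1 : ℕ) * h)
        = a * (a ^ k * totalWeight w ε n (X - h - k * h)) := by
          rw [pow_succ']
          push_cast
          ring_nf
      _ ≤ (∑ j with ε j ≤ h, w j) * totalWeight w ε (n + k) (X - h) := by
          gcongr
          · exact mul_nonneg (pow_nonneg ha _) (totalWeight_nonneg hw _ _)
          · exact ha.trans hah
          · exact ih _
      _ ≤ ∑ j with ε j ≤ h, w j * totalWeight w ε (n + k) (X - ε j) := by
          rw [Finset.sum_mul]
          refine Finset.sum_le_sum fun j hj => ?_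
          have := (Finset.mem_filter.1 hj).2
          exact mul_le_mul_of_nonneg_left (totalWeight_mono hw _ (by linarith)) (hw j)
      _ ≤ _ := Finset.sum_le_sum_of_subset_of_nonneg (Finset.filter_subset _ _)
          fun j _ _ => mul_nonneg (hw j) (totalWeight_nonneg hw _ _)

lemma pow_le_totalWeight (hw : ∀ j, 0 ≤ w j) {a h : ℝ} (ha : 0 ≤ a)
    (hah : a ≤ ∑ j with ε j ≤ h, w j) (n : ℕ) {X : ℝ} (hX : n * h ≤ X) :
    a ^ n ≤ totalWeight w ε n X := by
  have h0 := pow_mul_totalWeight_le hw ha hah 0 n X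
  have h1 : totalWeight w ε 0 (X - n * h) = 1 := by
    simp [totalWeight, sampleWeight, hX]
  rwa [h1, mul_one, zero_add] at h0

/-- Chernoff bound for the samples in which at least half of the energies are at most `h`. -/
lemma sum_sampleWeight_low_le (hw : ∀ j, 0 ≤ w j) {b Λ z h : ℝ} (hb : 0 ≤ b)
    (hε : ∀ j, 0 ≤ ε j) (hz : 1 ≤ z) (hf : ∑ j, w j * Real.exp (-b * ε j) ≤ Λ)
    (hlow : ∑ j with ε j ≤ h, w j ≤ Λ / z ^ 2) (n : ℕ) (X : ℝ) :
    ∑ τ : Fin n → ι with n ≤ 2 * #{i | ε (τ i) ≤ h}, sampleWeight w ε X τ ≤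
      Real.exp (b * X) * (2 * Λ / z) ^ n := by
  have hz0 : 0 < z := by linarith
  -- Chernoff tilt: each low energy earns a factor `z ^ 2`, so a sample with half its energies low
  -- earns at least `z ^ n`. The low shells are light enough that the tilt at most doubles the bound
  -- `Λ`.
  set v : ι → ℝ := fun j => w j * Real.exp (-b * ε j) * (if ε j ≤ h then z ^ 2 else 1) with hv
  have hv0 : ∀ j, 0 ≤ v j := fun j => by
    have := hw j
    simp only [hv]
    split_ifs <;> positivity
  have hvsum : ∑ j, v j ≤ 2 * Λ := by
    have : ∀ j, v j ≤ w j * Real.exp (-b * ε j) + z ^ 2 * (if ε j ≤ h then w j else 0) := by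
      intro j
      have hj := hw j
      have he : Real.exp (-b * ε j) ≤ 1 := by
        rw [Real.exp_le_one_iff]
        nlinarith [hε j]
      simp only [hv]
      split_ifs
      · have : w j * Real.exp (-b * ε j) * z ^ 2 ≤ w j * 1 * z ^ 2 := by gcongr
        have : 0 ≤ w j * Real.exp (-b * ε j) := by positivity
        linarith
      · simp
    calc ∑ j, v j ≤ ∑ j, (w j * Real.exp (-b * ε j) + z ^ 2 * (if ε j ≤ h then w j else 0)) :=
          Finset.sum_le_sum fun j _ => this j
      _ = ∑ j, w j * Real.exp (-b * ε j) + z ^ 2 * ∑ j with ε j ≤ h, w j := by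
          rw [Finset.sum_add_distrib, ← Finset.mul_sum, Finset.sum_filter]
      _ ≤ Λ + z ^ 2 * (Λ / z ^ 2) := by gcongr
      _ = 2 * Λ := by field_simp; ring
  have hpow : ∀ τ : Fin n → ι, n ≤ 2 * #{i | ε (τ i) ≤ h} →
      z ^ n * sampleWeight w ε X τ ≤ Real.exp (b * X) * ∏ i, v (τ i) := by
    intro τ hτ
    have hprod : ∏ i, v (τ i) = (∏ i, w (τ i)) * Real.exp (-b * ∑ i, ε (τ i)) *
        z ^ (2 * #{i | ε (τ i) ≤ h}) := by
      simp only [hv, Finset.prod_mul_distrib, Finset.mul_sum, Real.exp_sum]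
      rw [Finset.prod_ite, Finset.prod_const, Finset.prod_const_one, mul_one, ← pow_mul]
    unfold sampleWeight
    have hw' : 0 ≤ ∏ i, w (τ i) := Finset.prod_nonneg fun i _ => hw _
    split_ifs with hX
    · rw [hprod]
      have h1 : z ^ n ≤ z ^ (2 * #{i | ε (τ i) ≤ h}) := pow_le_pow_right₀ hz hτ
      have h2 : 1 ≤ Real.exp (b * X) * Real.exp (-b * ∑ i, ε (τ i)) := by
        rw [← Real.exp_add, Real.one_le_exp_iff]
        nlinarith
      calc z ^ n * ∏ i, w (τ i)
          ≤ z ^ (2 * #{i | ε (τ i) ≤ h}) * (∏ i, w (τ i)) * 1 := by rw [mul_one]; gcongr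
        _ ≤ z ^ (2 * #{i | ε (τ i) ≤ h}) * (∏ i, w (τ i)) *
            (Real.exp (b * X) * Real.exp (-b * ∑ i, ε (τ i))) := by gcongr
        _ = _ := by ring
    · rw [mul_zero]
      exact mul_nonneg (Real.exp_nonneg _) (Finset.prod_nonneg fun i _ => hv0 _)
  rw [div_pow, ← mul_div_assoc, le_div_iff₀ (by positivity), mul_comm, Finset.mul_sum]
  calc ∑ τ : Fin n → ι with n ≤ 2 * #{i | ε (τ i) ≤ h}, z ^ n * sampleWeight w ε X τ
      ≤ ∑ τ : Fin n → ι with n ≤ 2 * #{i | ε (τ i) ≤ h}, Real.exp (b * X) * ∏ i, v (τ i) :=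
        Finset.sum_le_sum fun τ hτ => hpow τ (Finset.mem_filter.1 hτ).2
    _ ≤ ∑ τ : Fin n → ι, Real.exp (b * X) * ∏ i, v (τ i) :=
        Finset.sum_le_sum_of_subset_of_nonneg (Finset.filter_subset _ _) fun τ _ _ =>
          mul_nonneg (Real.exp_nonneg _) (Finset.prod_nonneg fun i _ => hv0 _)
    _ = Real.exp (b * X) * (∑ j, v j) ^ n := by
        rw [← Finset.mul_sum, Fintype.sum_pow]
    _ ≤ Real.exp (b * X) * (2 * Λ) ^ n := by
        gcongr
        exact Finset.sum_nonneg fun j _ => hv0 j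

/-- Samples with many energies in `(h', D]` can be lowered by `h' - h₁` at bounded cost. -/
lemma sum_sampleWeight_mid_le (hw : ∀ j, 0 ≤ w j) {b Λ c h₁ h' D : ℝ} (hb : 0 ≤ b)
    (hc : 0 < c) (hΛ : 0 < Λ) (hf : ∑ j, w j * Real.exp (-b * ε j) ≤ Λ)
    (hlow : c * Λ ≤ ∑ j with ε j ≤ h₁, w j) (n : ℕ) (X : ℝ) :
    ∑ τ : Fin (n + 1) → ι with n + 1 ≤ 4 * #{i | h' < ε (τ i) ∧ ε (τ i) ≤ D},
        sampleWeight w ε (X + (h' - h₁)) τ ≤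
      4 * Real.exp (b * D) / c * totalWeight w ε (n + 1) X := by
  have hstep := pow_mul_totalWeight_le hw (by positivity) hlow n 1 X
  rw [pow_one, Nat.cast_one, one_mul] at hstep
  have hnn : (0 : ℝ) < n + 1 := by positivity
  have hmid : ∑ j with h' < ε j ∧ ε j ≤ D, w j ≤ Real.exp (b * D) * Λ := by
    calc ∑ j with h' < ε j ∧ ε j ≤ D, w j
        ≤ ∑ j with h' < ε j ∧ ε j ≤ D, Real.exp (b * D) * (w j * Real.exp (-b * ε j)) := by
          refine Finset.sum_le_sum fun j hj => ?_
          have hj' := (Finset.mem_filter.1 hj).2.2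
          have : 1 ≤ Real.exp (b * D) * Real.exp (-b * ε j) := by
            rw [← Real.exp_add, Real.one_le_exp_iff]
            nlinarith
          nlinarith [hw j]
      _ ≤ ∑ j, Real.exp (b * D) * (w j * Real.exp (-b * ε j)) :=
          Finset.sum_le_sum_of_subset_of_nonneg (Finset.filter_subset _ _) fun j _ _ =>
            mul_nonneg (Real.exp_nonneg _) (mul_nonneg (hw j) (Real.exp_nonneg _))
      _ ≤ _ := by rw [← Finset.mul_sum]; gcongr
  have hcount := sum_card_mul (w := w) (ε := ε) n (fun j => h' < ε j ∧ ε j ≤ D)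
    (X + (h' - h₁)) (fun _ => 1)
  simp only [mul_one, one_mul] at hcount
  have hA0 := totalWeight_nonneg (ε := ε) hw n (X - h₁)
  -- Markov for the number of middle energies, which is at least `(n + 1) / 4` on the samples
  -- considered.
  have h1 : ((n + 1 : ℝ)) * ∑ τ : Fin (n + 1) → ι with
        n + 1 ≤ 4 * #{i | h' < ε (τ i) ∧ ε (τ i) ≤ D}, sampleWeight w ε (X + (h' - h₁)) τ ≤
      4 * ∑ τ : Fin (n + 1) → ι, (#{i | h' < ε (τ i) ∧ ε (τ i) ≤ D} : ℝ) *
        sampleWeight w ε (X + (h' - h₁)) τ := by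
    rw [Finset.mul_sum, Finset.mul_sum, Finset.sum_filter]
    refine Finset.sum_le_sum fun τ _ => ?_
    have h0 := sampleWeight_nonneg (ε := ε) hw (X + (h' - h₁)) τ
    split_ifs with h
    · rw [← mul_assoc]
      gcongr
      exact_mod_cast h
    · positivity
  -- Removing an energy above `h'` from the bound `X + (h' - h₁)` leaves less than `X - h₁`, exactly
  -- the bound left when a coordinate of energy at most `h₁` is added under `X`. This is the
  -- exchange.
  have h2 : ∑ j with h' < ε j ∧ ε j ≤ D, w j * totalWeight w ε n (X + (h' - h₁) - ε j) ≤
      Real.exp (b * D) * Λ * totalWeight w ε n (X - h₁) := by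
    calc _ ≤ ∑ j with h' < ε j ∧ ε j ≤ D, w j * totalWeight w ε n (X - h₁) := by
          refine Finset.sum_le_sum fun j hj => ?_
          have hj' := (Finset.mem_filter.1 hj).2.1
          exact mul_le_mul_of_nonneg_left (totalWeight_mono hw _ (by linarith)) (hw j)
      _ ≤ _ := by rw [← Finset.sum_mul]; gcongr
  rw [hcount] at h1
  have h3 : (n + 1 : ℝ) * ∑ τ : Fin (n + 1) → ι with
        n + 1 ≤ 4 * #{i | h' < ε (τ i) ∧ ε (τ i) ≤ D}, sampleWeight w ε (X + (h' - h₁)) τ ≤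
      (n + 1 : ℝ) * (4 * (Real.exp (b * D) * Λ * totalWeight w ε n (X - h₁))) := by
    refine h1.trans ?_
    rw [mul_left_comm]
    exact mul_le_mul_of_nonneg_left (mul_le_mul_of_nonneg_left h2 (by norm_num)) hnn.le
  refine (le_of_mul_le_mul_left h3 hnn).trans ?_
  rw [div_mul_eq_mul_div, le_div_iff₀ hc]
  calc 4 * (Real.exp (b * D) * Λ * totalWeight w ε n (X - h₁)) * c
      = 4 * Real.exp (b * D) * (c * Λ * totalWeight w ε n (X - h₁)) := by ring
    _ ≤ _ := by gcongr

/-- Raising the energy bound by `h' - h₁` multiplies the total weight by a bounded factor. -/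
lemma totalWeight_add_le (hw : ∀ j, 0 ≤ w j) (hε : ∀ j, 0 ≤ ε j)
    {b Λ z c c' h h₁ h' D : ℝ} (hb : 0 ≤ b) (hc : 0 < c) (hc' : 0 < c') (hΛ : 0 < Λ) (hz : 1 ≤ z)
    (hD : 0 < D)
    (hf : ∑ j, w j * Real.exp (-b * ε j) ≤ Λ)
    (hlow : c * Λ ≤ ∑ j with ε j ≤ h₁, w j)
    (hlow' : ∑ j with ε j ≤ h', w j ≤ Λ / z ^ 2)
    (hmean : c' * Λ ≤ ∑ j with ε j ≤ h, w j) {n : ℕ} (hn : 0 < n) {X : ℝ}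
    (hX : n * h ≤ X) (hXD : X + (h' - h₁) ≤ n * D / 4)
    (hzD : 2 * Real.exp (b * D / 4) ≤ c' * z) :
    totalWeight w ε n (X + (h' - h₁)) ≤
      (4 * Real.exp (b * D) / c + 1) * totalWeight w ε n X := by
  have hz0 : 0 < z := by linarith
  obtain ⟨k, rfl⟩ := Nat.exists_eq_add_of_le' hn
  set Y := X + (h' - h₁) with hY
  have hbad := sum_sampleWeight_low_le hw hb hε hz hf hlow' (k + 1) Y
  have hgood := sum_sampleWeight_mid_le (D := D) (h' := h') hw hb hc hΛ hf hlow k X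
  have hA := pow_le_totalWeight hw (by positivity) hmean (k + 1) hX
  -- `Y ≤ (k + 1) * D / 4` turns the exponential into a `(k + 1)`-st power, and `hzD` makes `z`
  -- large enough to win per coordinate. By `hA` the right side is below the total weight at `X`.
  have hbad' : Real.exp (b * Y) * (2 * Λ / z) ^ (k + 1) ≤ (c' * Λ) ^ (k + 1) := by
    have h1 : Real.exp (b * Y) ≤ Real.exp (b * D / 4) ^ (k + 1) := by
      rw [← Real.exp_nat_mul]
      apply Real.exp_le_exp.2
      calc b * Y ≤ b * (((k + 1 : ℕ) : ℝ) * D / 4) := by gcongr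
        _ = _ := by ring
    calc _ ≤ Real.exp (b * D / 4) ^ (k + 1) * (2 * Λ / z) ^ (k + 1) := by gcongr
      _ = (2 * Real.exp (b * D / 4) * Λ / z) ^ (k + 1) := by rw [← mul_pow]; ring_nf
      _ ≤ _ := by
        gcongr
        rw [div_le_iff₀ hz0]
        calc _ ≤ c' * z * Λ := by gcongr
          _ = _ := by ring
  have hsplit : totalWeight w ε (k + 1) Y ≤
      ∑ τ : Fin (k + 1) → ι with k + 1 ≤ 4 * #{i | h' < ε (τ i) ∧ ε (τ i) ≤ D},
        sampleWeight w ε Y τ +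
      ∑ τ : Fin (k + 1) → ι with k + 1 ≤ 2 * #{i | ε (τ i) ≤ h'}, sampleWeight w ε Y τ := by
    rw [totalWeight, Finset.sum_filter, Finset.sum_filter, ← Finset.sum_add_distrib]
    refine Finset.sum_le_sum fun τ _ => ?_
    have h0 := sampleWeight_nonneg (ε := ε) hw Y τ
    by_cases h1 : k + 1 ≤ 2 * #{i | ε (τ i) ≤ h'}
    · rw [if_pos h1]
      split_ifs <;> linarith
    by_cases h2 : ∑ i, ε (τ i) ≤ Y
    swap
    · simp [sampleWeight, h2]
    -- Markov: the energies sum to at most `(k + 1) * D / 4`. With fewer than half of them low and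
    -- at most a quarter high, at least a quarter lie in between.
    have hhigh : 4 * #{i | D < ε (τ i)} ≤ k + 1 := by
      have : (#{i | D < ε (τ i)} : ℝ) * D ≤ ((k + 1 : ℕ) : ℝ) * D / 4 := by
        calc (#{i | D < ε (τ i)} : ℝ) * D = ∑ i with D < ε (τ i), D := by simp
          _ ≤ ∑ i with D < ε (τ i), ε (τ i) :=
            Finset.sum_le_sum fun i hi => (Finset.mem_filter.1 hi).2.le
          _ ≤ ∑ i, ε (τ i) := Finset.sum_le_sum_of_subset_of_nonneg (Finset.filter_subset _ _)
            fun i _ _ => hε _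
          _ ≤ _ := h2.trans hXD
      have h4 : (4 * #{i | D < ε (τ i)} : ℝ) * D ≤ ((k + 1 : ℕ) : ℝ) * D := by linarith
      exact_mod_cast le_of_mul_le_mul_right h4 hD
    have hcard : k + 1 ≤ #{i | ε (τ i) ≤ h'} + #{i | h' < ε (τ i) ∧ ε (τ i) ≤ D} +
        #{i | D < ε (τ i)} := by
      have : (Finset.univ : Finset (Fin (k + 1))) ⊆ (({i | ε (τ i) ≤ h'} : Finset (Fin (k + 1))) ∪
          ({i | h' < ε (τ i) ∧ ε (τ i) ≤ D} : Finset (Fin (k + 1)))) ∪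
          ({i | D < ε (τ i)} : Finset (Fin (k + 1))) := by
        intro i _
        simp only [Finset.mem_union, Finset.mem_filter, Finset.mem_univ, true_and]
        by_cases ha : ε (τ i) ≤ h'
        · exact .inl (.inl ha)
        by_cases hd : ε (τ i) ≤ D
        · exact .inl (.inr ⟨not_le.1 ha, hd⟩)
        · exact .inr (not_le.1 hd)
      have h5 := Finset.card_le_card this
      rw [Finset.card_univ, Fintype.card_fin] at h5
      exact h5.trans ((Finset.card_union_le _ _).trans
        (Nat.add_le_add_right (Finset.card_union_le _ _) _))
    have h3 : k + 1 ≤ 4 * #{i | h' < ε (τ i) ∧ ε (τ i) ≤ D} := by omega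
    rw [if_pos h3, if_neg h1, add_zero]
  calc _ ≤ _ := hsplit
    _ ≤ 4 * Real.exp (b * D) / c * totalWeight w ε (k + 1) X + totalWeight w ε (k + 1) X :=
      add_le_add hgood (hbad.trans (hbad'.trans hA))
    _ = _ := by ring

/-- The samples that contain `l` at least `K` times are rare. -/
theorem sum_sampleWeight_card_ge_le [DecidableEq ι] (hw : ∀ j, 0 ≤ w j) (hw1 : ∀ j, w j ≤ 1)
    (hε : ∀ j, 0 ≤ ε j) {b z c c' h h₁ h' : ℝ} (hb : 0 ≤ b) (hc : 0 < c) (hc' : 0 < c')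
    (hz : 1 ≤ z) (h₁0 : 0 ≤ h₁) (h₁h' : h₁ < h') (h'h : h' ≤ h) {n K q : ℕ} (hKn : K ≤ n)
    (hn : 0 < n) (hq : h₁ ≤ q * (h' - h₁)) (hqh : q * (h' - h₁) ≤ h)
    (hf : ∑ j, w j * Real.exp (-b * ε j) ≤ (n + K : ℕ))
    (hlow : c * (n + K : ℕ) ≤ ∑ j with ε j ≤ h₁, w j)
    (hlow' : ∑ j with ε j ≤ h', w j ≤ (n + K : ℕ) / z ^ 2)
    (hmean : c' * (n + K : ℕ) ≤ ∑ j with ε j ≤ h, w j)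
    (hzD : 2 * Real.exp (4 * b * h) ≤ c' * z) (l : ι) :
    ∑ τ : Fin (n + K) → ι with K ≤ #{i | τ i = l},
        sampleWeight w ε ((n + K : ℕ) * h) τ ≤
      ((4 * Real.exp (16 * b * h) / c + 1) ^ q / c) ^ K / K.factorial *
        totalWeight w ε (n + K) ((n + K : ℕ) * h) := by
  set X : ℝ := (n + K : ℕ) * h with hX
  set C := 4 * Real.exp (16 * b * h) / c + 1 with hC
  have hC0 : 0 ≤ C := by positivity
  have hh : 0 < h := by linarith
  have hL : (0 : ℝ) < (n + K : ℕ) := by positivity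
  have hnR : (0 : ℝ) < n := by exact_mod_cast hn
  have hKR : (K : ℝ) ≤ n := by exact_mod_cast hKn
  have hK0 : (0 : ℝ) ≤ K := by positivity
  have hXe : X = n * h + K * h := by rw [hX]; push_cast; ring
  have hiter : ∀ r : ℕ, r ≤ q * K →
      totalWeight w ε n (X - K * h₁ + r * (h' - h₁)) ≤
        C ^ r * totalWeight w ε n (X - K * h₁) := by
    intro r
    induction r with
    | zero => simp
    | succ r ih =>
      intro hr
      have hr' : ((r : ℝ) + 1) ≤ q * K := by exact_mod_cast hr
      have hδ : 0 < h' - h₁ := by linarith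
      have hr2 : ((r : ℝ) + 1) * (h' - h₁) ≤ K * h := by
        calc ((r : ℝ) + 1) * (h' - h₁) ≤ q * K * (h' - h₁) := by gcongr
          _ = K * (q * (h' - h₁)) := by ring
          _ ≤ _ := by gcongr
      have hr3 : 0 ≤ (r : ℝ) * (h' - h₁) := by positivity
      have hKh : K * h₁ ≤ K * h := by gcongr; linarith
      have hKh0 : 0 ≤ K * h₁ := by positivity
      have hKn' : K * h ≤ n * h := by gcongr
      -- Throughout the iteration the energy bound stays between `n * h` and `3 * n * h`, because `K
      -- ≤ n`; so `D = 16 * h` meets the requirement `≤ n * D / 4` with room to spare.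
      have step := totalWeight_add_le (D := 16 * h) (X := X - K * h₁ + r * (h' - h₁)) hw hε hb hc
        hc' hL hz (by linarith) hf hlow hlow' hmean hn (by linarith) (by linarith)
        (by convert hzD using 3; ring)
      have e1 : X - K * h₁ + ((r + 1 : ℕ) : ℝ) * (h' - h₁) =
          X - K * h₁ + r * (h' - h₁) + (h' - h₁) := by push_cast; ring
      rw [e1]
      refine step.trans ?_
      rw [pow_succ', mul_assoc]
      have e2 : b * (16 * h) = 16 * b * h := by ring
      rw [e2]
      exact mul_le_mul_of_nonneg_left (ih (by omega)) hC0
  -- `q` steps of length `h' - h₁` cover `h₁`, so `q * K` steps climb back from `X - K * h₁` to at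
  -- least `X`.
  have hA : totalWeight w ε n X ≤ C ^ (q * K) * totalWeight w ε n (X - K * h₁) := by
    refine (totalWeight_mono hw n ?_).trans (hiter (q * K) le_rfl)
    have : K * h₁ ≤ K * (q * (h' - h₁)) := by gcongr
    push_cast
    linarith
  have hB := pow_mul_totalWeight_le hw (by positivity) hlow n K X
  have hB0 := totalWeight_nonneg (ε := ε) hw n (X - K * h₁)
  calc _ ≤ _ := sum_sampleWeight_card_ge hw hw1 hε l n K X
    _ ≤ ((n + K : ℕ) : ℝ) ^ K / K.factorial *
        (C ^ (q * K) * totalWeight w ε n (X - K * h₁)) := by gcongr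
    _ = (C ^ q / c) ^ K / K.factorial *
        ((c * (n + K : ℕ)) ^ K * totalWeight w ε n (X - K * h₁)) := by
      rw [div_pow, mul_pow, ← pow_mul]
      field_simp
    _ ≤ _ := by gcongr

end Sampling

/-! ### The Hamiltonian and its null level sets -/

section Hamiltonian

lemma hamiltonian_nonneg {N : ℕ} {mass : ℝ} (hmass : 0 < mass)
    {U : EuclideanSpace ℝ (Fin (3 * N)) → ℝ} (hU0 : ∀ q, 0 ≤ U q) (x : PhaseSpace N) :
    0 ≤ hamiltonian mass U x := by
  unfold hamiltonian
  have := hU0 x.2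
  positivity

lemma measurable_hamiltonian {N : ℕ} (mass : ℝ) {U : EuclideanSpace ℝ (Fin (3 * N)) → ℝ}
    (hU : Measurable U) : Measurable (hamiltonian mass U) := by
  unfold hamiltonian
  fun_prop

/-- For fixed `q` the admissible momenta lie on a sphere, null in positive dimension; then Fubini.
The kinetic term alone does the work, so `U` may be constant on large sets. -/
lemma volume_hamiltonian_eq {N : ℕ} (hN : 1 ≤ N) {mass : ℝ} (hmass : 0 < mass)
    {U : EuclideanSpace ℝ (Fin (3 * N)) → ℝ} (hU : Measurable U) (c : ℝ) :
    volume {x : PhaseSpace N | hamiltonian mass U x = c} = 0 := by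
  have hm : MeasurableSet {x : PhaseSpace N | hamiltonian mass U x = c} :=
    measurable_hamiltonian mass hU (measurableSet_singleton c)
  have : Nonempty (Fin (3 * N)) := ⟨⟨0, by omega⟩⟩
  rw [Measure.volume_eq_prod, Measure.prod_apply_symm hm, lintegral_eq_zero_of_ae_eq_zero]
  refine Eventually.of_forall fun q => ?_
  refine measure_mono_null (t := Metric.sphere 0 (√(2 * mass * (c - U q)))) ?_
    (Measure.addHaar_sphere _ _ _)
  intro p hp
  have hp' : ‖p‖ ^ 2 / (2 * mass) + U q = c := hp
  rw [mem_sphere_zero_iff_norm]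
  have : 2 * mass * (c - U q) = ‖p‖ ^ 2 := by
    rw [← hp']
    field_simp
    ring
  rw [this, Real.sqrt_sq (norm_nonneg p)]

end Hamiltonian

/-! ### Measures of sublevel sets -/

section Sublevel

variable {α : Type*} [MeasurableSpace α] {μ : Measure α} {H : α → ℝ} {b : ℝ}

/-- Markov's inequality for `exp (-b * H)`. -/
lemma measure_sublevel_lt_top (hb : 0 < b) (hZ : Integrable (fun x => Real.exp (-b * H x)) μ)
    (c : ℝ) : μ {x | H x ≤ c} < ∞ := by
  refine (measure_mono ?_).trans_lt (hZ.measure_ge_lt_top (Real.exp_pos (-b * c)))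
  intro x hx
  have : H x ≤ c := hx
  simp only [Set.mem_ofPred_eq, Real.exp_le_exp]
  nlinarith

/-- The mean energy of the Gibbs distribution is not below the essential infimum of the energy. -/
lemma measure_sublevel_mean_pos [NeZero μ] (hZ : Integrable (fun x => Real.exp (-b * H x)) μ)
    (hHZ : Integrable (fun x => H x * Real.exp (-b * H x)) μ) {h : ℝ}
    (hh : h * ∫ x, Real.exp (-b * H x) ∂μ = ∫ x, H x * Real.exp (-b * H x) ∂μ) :
    0 < μ {x | H x ≤ h} := by
  rw [pos_iff_ne_zero]
  intro h0
  have hae : ∀ᵐ x ∂μ, h < H x := by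
    filter_upwards [measure_eq_zero_iff_ae_notMem.1 h0] with x hx using not_le.1 hx
  -- The Gibbs average of `H - h` vanishes, which is impossible if `H > h` almost everywhere.
  have hint : ∫ x, (H x - h) * Real.exp (-b * H x) ∂μ = 0 := by
    simp only [sub_mul]
    rw [integral_sub hHZ (hZ.const_mul h), integral_const_mul, hh, sub_self]
  have hi : Integrable (fun x => (H x - h) * Real.exp (-b * H x)) μ := by
    simp only [sub_mul]
    exact hHZ.sub (hZ.const_mul h)
  rw [integral_eq_zero_iff_of_nonneg_ae _ hi] at hint
  · have : ∀ᵐ _ ∂μ, False := by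
      filter_upwards [hint, hae] with x h1 h2
      have h3 : (H x - h) * Real.exp (-b * H x) = 0 := h1
      have : 0 < (H x - h) * Real.exp (-b * H x) := mul_pos (by linarith) (Real.exp_pos _)
      linarith
    rw [eventually_false_iff_eq_bot, ae_eq_bot] at this
    exact NeZero.ne μ this
  · filter_upwards [hae] with x hx
    exact mul_nonneg (by linarith) (Real.exp_nonneg _)

/-- There are sublevel sets of arbitrarily small positive measure below a given one. -/
lemma exists_sublevel_small (hH : Measurable H) (hH0 : ∀ x, 0 ≤ H x)
    (hnull : ∀ c, μ {x | H x = c} = 0) (hfin : ∀ c, μ {x | H x ≤ c} < ∞) {h : ℝ}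
    (hh : 0 < μ {x | H x ≤ h}) {η : ℝ} (hη : 0 < η) :
    ∃ h₁ h', 0 ≤ h₁ ∧ h₁ < h' ∧ h' ≤ h ∧ 0 < μ.real {x | H x ≤ h₁} ∧
      μ.real {x | H x ≤ h'} ≤ η := by
  -- The infimum `u` of `S` is the essential infimum of `H`. Its own sublevel set is null because
  -- the level `u` is, so by continuity from above the measure tends to `0` as the level decreases
  -- to `u`, while staying positive.
  set S : Set ℝ := {c | 0 < μ {x | H x ≤ c}} with hS
  have hS0 : ∀ c ∈ S, 0 ≤ c := by
    intro c hc
    by_contra hlt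
    have : {x | H x ≤ c} = ∅ := by
      ext x
      simp only [Set.mem_ofPred_eq, Set.mem_empty_iff_false, iff_false, not_le]
      linarith [hH0 x]
    simp [hS, this] at hc
  have hbdd : BddBelow S := ⟨0, hS0⟩
  set u := sInf S with hu
  have hmono : ∀ {c d : ℝ}, c ≤ d → {x | H x ≤ c} ⊆ {x | H x ≤ d} :=
    fun hcd x hx => le_trans (show H x ≤ _ from hx) hcd
  have habove : ∀ c, u < c → 0 < μ {x | H x ≤ c} := by
    intro c hc
    obtain ⟨d, hd, hdc⟩ := exists_lt_of_csInf_lt ⟨h, hh⟩ hc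
    exact lt_of_lt_of_le (show 0 < μ {x | H x ≤ d} from hd) (measure_mono (hmono hdc.le))
  have hu0 : μ {x | H x ≤ u} = 0 := by
    have hlt : μ {x | H x < u} = 0 := by
      have : {x | H x < u} = ⋃ n : ℕ, {x | H x ≤ u - 1 / ((n : ℝ) + 1)} := by
        ext x
        simp only [Set.mem_ofPred_eq, Set.mem_iUnion]
        constructor
        · intro hx
          obtain ⟨n, hn⟩ := exists_nat_one_div_lt (sub_pos.2 hx)
          exact ⟨n, by linarith⟩
        · rintro ⟨n, hn⟩
          have : (0 : ℝ) < 1 / ((n : ℝ) + 1) := by positivity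
          linarith
      rw [this]
      refine measure_iUnion_null fun n => ?_
      by_contra hne
      have h1 : u ≤ u - 1 / ((n : ℝ) + 1) := csInf_le hbdd (pos_iff_ne_zero.2 hne)
      have : (0 : ℝ) < 1 / ((n : ℝ) + 1) := by positivity
      linarith
    have : {x | H x ≤ u} = {x | H x < u} ∪ {x | H x = u} := by
      ext x
      exact le_iff_lt_or_eq (a := H x)
    rw [this]
    exact measure_union_null hlt (hnull u)
  have huh : u < h := by
    refine lt_of_le_of_ne (csInf_le hbdd hh) ?_
    intro he
    rw [he] at hu0
    exact hh.ne' hu0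
  have hu_nonneg : 0 ≤ u := le_csInf ⟨h, hh⟩ hS0
  have hlim := tendsto_measure_biInter_gt (μ := μ) (s := fun c => {x | H x ≤ c}) (a := u)
    (fun r _ => (measurableSet_le hH measurable_const).nullMeasurableSet)
    (fun i j _ hij => hmono hij) ⟨h, huh, (hfin h).ne⟩
  have hInter : ⋂ r > u, {x | H x ≤ r} = {x | H x ≤ u} := by
    ext x
    simp only [Set.mem_iInter, Set.mem_ofPred_eq]
    exact ⟨fun hx => le_of_forall_gt_imp_ge_of_dense hx, fun hx r hr => hx.trans hr.le⟩
  rw [hInter, hu0] at hlim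
  have hev : ∀ᶠ r in 𝓝[>] u, μ {x | H x ≤ r} < ENNReal.ofReal η :=
    hlim.eventually (gt_mem_nhds (ENNReal.ofReal_pos.2 hη))
  obtain ⟨h', ⟨hlt, hle⟩, huh'⟩ := ((hev.and (eventually_nhdsWithin_of_eventually_nhds
    (eventually_le_nhds huh))).and self_mem_nhdsWithin).exists
  have huh'' : u < h' := huh'
  refine ⟨(u + h') / 2, h', by linarith, by linarith, hle, ?_, ?_⟩
  · exact ENNReal.toReal_pos (habove _ (by linarith)).ne' (hfin _).ne
  · exact ENNReal.toReal_le_of_le_ofReal hη.le hlt.le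

end Sublevel

/-! ### Energy shells: mean energies, Jensen's inequality, volume comparison -/

section Shells

variable {N s : ℕ} {H : PhaseSpace N → ℝ} {Δω Etot : ℝ} {E : Fin (s + 1) → ℝ}

lemma measurableSet_shell (hH : Measurable H) (l : Fin s) : MeasurableSet (shell H E l) :=
  (measurableSet_le measurable_const hH).inter (measurableSet_le hH measurable_const)

lemma IsShellPartition.nonneg (hE : IsShellPartition H Δω Etot E) (k : Fin (s + 1)) : 0 ≤ E k := by
  rw [← hE.first]
  exact hE.strictMono.monotone (Fin.zero_le k)

lemma IsShellPartition.volume_lt_top (hE : IsShellPartition H Δω Etot E) (l : Fin s) :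
    volume (shell H E l) < ∞ :=
  (hE.volume_le l).trans_lt ENNReal.ofReal_lt_top

lemma IsShellPartition.volume_real_le (hE : IsShellPartition H Δω Etot E) (hΔ : 0 ≤ Δω)
    (l : Fin s) : volume.real (shell H E l) ≤ Δω :=
  ENNReal.toReal_le_of_le_ofReal hΔ (hE.volume_le l)

lemma IsShellPartition.succ_le_castSucc (hE : IsShellPartition H Δω Etot E) {i j : Fin s}
    (hij : i < j) : E i.succ ≤ E j.castSucc :=
  hE.strictMono.monotone (by
    rw [Fin.le_def, Fin.val_succ, Fin.val_castSucc]
    exact hij)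

lemma IsShellPartition.aedisjoint (hE : IsShellPartition H Δω Etot E)
    (hnull : ∀ c, volume {x | H x = c} = 0) :
    Pairwise (Function.onFun (AEDisjoint volume) (shell H E)) := by
  have key : ∀ i j : Fin s, i < j → volume (shell H E i ∩ shell H E j) = 0 := by
    intro i j hij
    refine measure_mono_null ?_ (hnull (E j.castSucc))
    rintro x ⟨hi, hj⟩
    exact le_antisymm (hi.2.trans (hE.succ_le_castSucc hij)) hj.1
  intro i j hij
  rcases lt_or_gt_of_ne hij with h | h
  · exact key i j h
  · have := key j i h
    rw [Set.inter_comm] at this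
    exact this

lemma IsShellPartition.integrableOn (hE : IsShellPartition H Δω Etot E) (hH : Measurable H)
    (l : Fin s) : IntegrableOn H (shell H E l) := by
  refine Measure.integrableOn_of_bounded (M := E l.succ) (hE.volume_lt_top l).ne
    hH.aestronglyMeasurable ?_
  filter_upwards [ae_restrict_mem (measurableSet_shell hH l)] with x hx
  rw [Real.norm_of_nonneg ((hE.nonneg _).trans hx.1)]
  exact hx.2

lemma IsShellPartition.shellEnergy_mem (hE : IsShellPartition H Δω Etot E) (hH : Measurable H)
    {l : Fin s} (hl : volume (shell H E l) ≠ 0) :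
    shellEnergy H E l ∈ Set.Icc (E l.castSucc) (E l.succ) :=
  (convex_Icc _ _).set_average_mem isClosed_Icc hl (hE.volume_lt_top l).ne
    (by filter_upwards [ae_restrict_mem (measurableSet_shell hH l)] with x hx using hx)
    (hE.integrableOn hH l)

/-- A null shell has the default mean energy `0`, possibly outside its energy range; this does no
harm because its weight is zero. -/
lemma shellEnergy_eq_zero {l : Fin s} (hl : volume (shell H E l) = 0) :
    shellEnergy H E l = 0 := by
  rw [shellEnergy, Measure.restrict_eq_zero.2 hl, average_zero_measure]

lemma IsShellPartition.shellEnergy_nonneg (hE : IsShellPartition H Δω Etot E)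
    (hH : Measurable H) (l : Fin s) : 0 ≤ shellEnergy H E l := by
  by_cases hl : volume (shell H E l) = 0
  · rw [shellEnergy_eq_zero hl]
  · exact (hE.nonneg _).trans (hE.shellEnergy_mem hH hl).1

lemma IsShellPartition.shellEnergy_le (hE : IsShellPartition H Δω Etot E)
    (hH : Measurable H) (l : Fin s) : shellEnergy H E l ≤ E l.succ := by
  by_cases hl : volume (shell H E l) = 0
  · rw [shellEnergy_eq_zero hl]
    exact hE.nonneg _
  · exact (hE.shellEnergy_mem hH hl).2

lemma convexOn_exp_mul (b : ℝ) : ConvexOn ℝ Set.univ fun y : ℝ => Real.exp (-b * y) :=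
  convexOn_exp.comp_linearMap (LinearMap.lsmul ℝ ℝ (-b))

/-- Jensen's inequality for the convex function `exp (-b * y)`. -/
lemma IsShellPartition.volume_mul_exp_le (hE : IsShellPartition H Δω Etot E)
    (hH : Measurable H) {b : ℝ} (hZ : Integrable fun x => Real.exp (-b * H x)) (l : Fin s) :
    volume.real (shell H E l) * Real.exp (-b * shellEnergy H E l) ≤
      ∫ x in shell H E l, Real.exp (-b * H x) := by
  by_cases hl : volume (shell H E l) = 0
  · rw [measureReal_def, hl, ENNReal.toReal_zero, zero_mul]
    exact integral_nonneg fun x => Real.exp_nonneg _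
  have hpos : 0 < volume.real (shell H E l) :=
    ENNReal.toReal_pos hl (hE.volume_lt_top l).ne
  have hJ := (convexOn_exp_mul b).map_set_average_le (f := H) (t := shell H E l) (μ := volume)
    (by fun_prop) isClosed_univ hl (hE.volume_lt_top l).ne (by simp)
    (hE.integrableOn hH l) hZ.integrableOn
  rw [setAverage_eq volume fun x => Real.exp (-b * H x), smul_eq_mul, inv_mul_eq_div,
    le_div_iff₀ hpos, mul_comm] at hJ
  exact hJ

lemma IsShellPartition.sum_volume_mul_exp_le (hE : IsShellPartition H Δω Etot E)
    (hH : Measurable H) (hnull : ∀ c, volume {x | H x = c} = 0)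
    {b : ℝ} (hZ : Integrable fun x => Real.exp (-b * H x)) :
    ∑ l, volume.real (shell H E l) * Real.exp (-b * shellEnergy H E l) ≤
      ∫ x, Real.exp (-b * H x) := by
  refine (Finset.sum_le_sum fun l _ => hE.volume_mul_exp_le hH hZ l).trans ?_
  have := integral_iUnion_ae (μ := volume)
    (fun l => (measurableSet_shell (E := E) hH l).nullMeasurableSet)
    (hE.aedisjoint hnull) (hZ.integrableOn (s := ⋃ l, shell H E l))
  rw [tsum_fintype] at this
  rw [← this]
  exact setIntegral_le_integral hZ (Eventually.of_forall fun x => Real.exp_nonneg _)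

/-- At most one shell straddles a given level. Replacing a sublevel set by a union of shells
therefore costs at most one `Δω`. -/
lemma IsShellPartition.sum_straddling_le (hE : IsShellPartition H Δω Etot E) (hΔ : 0 ≤ Δω)
    (c : ℝ) :
    ∑ l with E l.castSucc ≤ c ∧ c < E l.succ, volume.real (shell H E l) ≤ Δω := by
  have hcard : #{l : Fin s | E l.castSucc ≤ c ∧ c < E l.succ} ≤ 1 := by
    rw [Finset.card_le_one]
    intro i hi j hj
    simp only [Finset.mem_filter, Finset.mem_univ, true_and] at hi hj
    rcases lt_trichotomy i j with h | h | h
    · linarith [hE.succ_le_castSucc h]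
    · exact h
    · linarith [hE.succ_le_castSucc h]
  calc _ ≤ ∑ l : Fin s with E l.castSucc ≤ c ∧ c < E l.succ, Δω :=
        Finset.sum_le_sum fun l _ => hE.volume_real_le hΔ l
    _ = #{l : Fin s | E l.castSucc ≤ c ∧ c < E l.succ} * Δω := by simp
    _ ≤ 1 * Δω := by gcongr; exact_mod_cast hcard
    _ = Δω := one_mul _

lemma IsShellPartition.sum_castSucc_le (hE : IsShellPartition H Δω Etot E) (hΔ : 0 ≤ Δω)
    (c : ℝ) :
    ∑ l with E l.castSucc ≤ c, volume.real (shell H E l) ≤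
      ∑ l with E l.succ ≤ c, volume.real (shell H E l) + Δω := by
  refine le_trans ?_ (add_le_add_right (hE.sum_straddling_le hΔ c) _)
  rw [Finset.sum_filter, Finset.sum_filter, Finset.sum_filter, ← Finset.sum_add_distrib]
  refine Finset.sum_le_sum fun l _ => ?_
  have h0 : 0 ≤ volume.real (shell H E l) := measureReal_nonneg
  by_cases h1 : E l.castSucc ≤ c
  · by_cases h2 : E l.succ ≤ c
    · simp [h1, h2, not_lt.2 h2]
    · simp [h1, h2, not_le.1 h2]
  · simp only [h1, if_false, false_and, add_zero]
    split_ifs <;> linarith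

lemma IsShellPartition.sum_volume_le (hE : IsShellPartition H Δω Etot E) (hΔ : 0 ≤ Δω)
    (hH : Measurable H) (hnull : ∀ c, volume {x | H x = c} = 0) {c : ℝ}
    (hfin : volume {x | H x ≤ c} < ∞) :
    ∑ l with shellEnergy H E l ≤ c, volume.real (shell H E l) ≤
      volume.real {x | H x ≤ c} + Δω := by
  calc _ ≤ ∑ l with E l.castSucc ≤ c, volume.real (shell H E l) := by
        rw [Finset.sum_filter, Finset.sum_filter]
        refine Finset.sum_le_sum fun l _ => ?_
        by_cases hl : volume (shell H E l) = 0
        · simp [measureReal_def, hl]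
        · split_ifs with h1 h2 h2
          · exact le_rfl
          · exact absurd ((hE.shellEnergy_mem hH hl).1.trans h1) h2
          · exact measureReal_nonneg
          · exact le_rfl
    _ ≤ _ := hE.sum_castSucc_le hΔ c
    _ ≤ _ := by
        gcongr
        rw [← measureReal_biUnion_finset₀ ((hE.aedisjoint hnull).set_pairwise _)
          (fun l _ => (measurableSet_shell hH l).nullMeasurableSet)
          (fun l _ => (hE.volume_lt_top l).ne)]
        refine measureReal_mono ?_ hfin.ne
        intro x hx
        simp only [Set.mem_iUnion, Finset.mem_filter] at hx
        obtain ⟨l, hl, hxl⟩ := hx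
        exact hxl.2.trans hl.2

/-- Strict positivity of the energy covers the case `s = 0`, where there is no shell; the level `0`
is null anyway. -/
lemma IsShellPartition.exists_mem_shell (hE : IsShellPartition H Δω Etot E) {x : PhaseSpace N}
    (hx0 : 0 < H x) (hx : H x ≤ Etot) : ∃ l, x ∈ shell H E l := by
  have key : ∀ k : Fin (s + 1), H x ≤ E k → ∃ l, x ∈ shell H E l := by
    intro k
    induction k using Fin.induction with
    | zero =>
      intro h
      rw [hE.first] at h
      linarith
    | succ l ih =>
      intro h
      by_cases h' : H x ≤ E l.castSucc
      · exact ih h'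
      · exact ⟨l, (not_le.1 h').le, h⟩
  exact key (Fin.last s) (hE.last ▸ hx)

lemma IsShellPartition.le_sum_volume (hE : IsShellPartition H Δω Etot E) (hΔ : 0 ≤ Δω)
    (hH : Measurable H) (hH0 : ∀ x, 0 ≤ H x) (hnull : ∀ c, volume {x | H x = c} = 0) {c : ℝ}
    (hc : c ≤ Etot) :
    volume.real {x | H x ≤ c} ≤
      ∑ l with shellEnergy H E l ≤ c, volume.real (shell H E l) + Δω := by
  have hcover : {x | H x ≤ c} ⊆
      {x | H x = 0} ∪ ⋃ l ∈ Finset.univ.filter (fun l : Fin s => E l.castSucc ≤ c),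
        shell H E l := by
    intro x hx
    have hxc : H x ≤ c := hx
    rcases (hH0 x).eq_or_lt with h | h
    · exact .inl h.symm
    · obtain ⟨l, hl⟩ := hE.exists_mem_shell h (hxc.trans hc)
      refine .inr (Set.mem_biUnion (x := l) ?_ hl)
      simp only [Finset.coe_filter, Finset.mem_univ, true_and, Set.mem_ofPred_eq]
      exact hl.1.trans hxc
  have hfin : volume (⋃ l ∈ Finset.univ.filter (fun l : Fin s => E l.castSucc ≤ c),
      shell H E l) ≠ ∞ :=
    ((measure_biUnion_finset_le _ _).trans_lt
      (ENNReal.sum_lt_top.2 fun l _ => hE.volume_lt_top l)).ne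
  calc volume.real {x | H x ≤ c}
      ≤ volume.real ({x | H x = 0} ∪
          ⋃ l ∈ Finset.univ.filter (fun l : Fin s => E l.castSucc ≤ c), shell H E l) :=
        measureReal_mono hcover (measure_union_ne_top (by rw [hnull]; simp) hfin)
    _ ≤ volume.real {x | H x = 0} +
          volume.real (⋃ l ∈ Finset.univ.filter (fun l : Fin s => E l.castSucc ≤ c),
            shell H E l) := measureReal_union_le _ _
    _ ≤ 0 + ∑ l with E l.castSucc ≤ c, volume.real (shell H E l) := by
        gcongr
        · rw [measureReal_def, hnull, ENNReal.toReal_zero]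
        · exact measureReal_biUnion_finset_le _ _
    _ ≤ ∑ l with E l.succ ≤ c, volume.real (shell H E l) + Δω := by
        rw [zero_add]
        exact hE.sum_castSucc_le hΔ c
    _ ≤ _ := by
        gcongr with l hl
        exact hE.shellEnergy_le hH l

end Shells

/-! ### From phase volume to weighted samples -/

section PhaseVolume

variable {N s : ℕ} {H : PhaseSpace N → ℝ} {Δω Etot : ℝ} {E : Fin (s + 1) → ℝ}

/-- The phase volume of a shell in units of `Δω`. -/
noncomputable def relVolume (H : PhaseSpace N → ℝ) (Δω : ℝ) (E : Fin (s + 1) → ℝ) (l : Fin s) : ℝ :=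
  volume.real (shell H E l) / Δω

/-- The set of `L`-tuples of phase points whose coordinates lie in the shells of the sample `τ`. -/
def sampleBox (H : PhaseSpace N → ℝ) (E : Fin (s + 1) → ℝ) {L : ℕ} (τ : Fin L → Fin s) :
    Set (Fin L → PhaseSpace N) :=
  Set.pi Set.univ fun i => shell H E (τ i)

lemma volume_sampleBox {L : ℕ} (τ : Fin L → Fin s) :
    volume (sampleBox H E τ) = ∏ i, volume (shell H E (τ i)) :=
  volume_pi_pi _

lemma measurableSet_sampleBox (hH : Measurable H) {L : ℕ} (τ : Fin L → Fin s) :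
    MeasurableSet (sampleBox H E τ) :=
  MeasurableSet.univ_pi fun i => measurableSet_shell hH (τ i)

lemma IsShellPartition.volume_sampleBox_ne_top (hE : IsShellPartition H Δω Etot E) {L : ℕ}
    (τ : Fin L → Fin s) : volume (sampleBox H E τ) ≠ ∞ := by
  rw [volume_sampleBox]
  exact ENNReal.prod_ne_top fun i _ => (hE.volume_lt_top _).ne

lemma volume_real_sampleBox (hΔ : 0 < Δω) {L : ℕ} (τ : Fin L → Fin s) :
    volume.real (sampleBox H E τ) = Δω ^ L * ∏ i, relVolume H Δω E (τ i) := by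
  rw [measureReal_def, volume_sampleBox, ENNReal.toReal_prod]
  simp only [relVolume, Finset.prod_div_distrib, Finset.prod_const, Finset.card_univ,
    Fintype.card_fin, ← measureReal_def]
  field_simp

lemma IsShellPartition.aedisjoint_sampleBox (hE : IsShellPartition H Δω Etot E)
    (hnull : ∀ c, volume {x | H x = c} = 0) (L : ℕ) :
    Pairwise (Function.onFun (AEDisjoint volume)
      (sampleBox H E : (Fin L → Fin s) → Set (Fin L → PhaseSpace N))) := by
  intro τ σ hτσ
  obtain ⟨i, hi⟩ := Function.ne_iff.1 hτσ
  have h0 : volume (shell H E (τ i) ∩ shell H E (σ i)) = 0 := hE.aedisjoint hnull hi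
  change volume (sampleBox H E τ ∩ sampleBox H E σ) = 0
  rw [sampleBox, sampleBox, ← Set.pi_inter_distrib, volume_pi_pi]
  exact Finset.prod_eq_zero (Finset.mem_univ i) h0

lemma admissible_eq_biUnion (L : ℕ) :
    admissible L H Etot E =
      ⋃ τ ∈ Finset.univ.filter (fun τ : Fin L → Fin s => ∑ i, shellEnergy H E (τ i) ≤ Etot),
        sampleBox H E τ := by
  ext ξ
  simp only [admissible, sampleBox, Set.mem_ofPred_eq, Set.mem_iUnion, Finset.mem_filter,
    Finset.mem_univ, true_and, Set.mem_univ_pi, exists_prop]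
  exact exists_congr fun τ => and_comm

lemma measurableSet_admissible (hH : Measurable H) (L : ℕ) :
    MeasurableSet (admissible L H Etot E) := by
  rw [admissible_eq_biUnion]
  exact Finset.measurableSet_biUnion _ fun τ _ => measurableSet_sampleBox hH τ

lemma IsShellPartition.volume_admissible_ne_top (hE : IsShellPartition H Δω Etot E) (L : ℕ) :
    volume (admissible L H Etot E) ≠ ∞ := by
  rw [admissible_eq_biUnion]
  exact ((measure_biUnion_finset_le _ _).trans_lt
    (ENNReal.sum_lt_top.2 fun τ _ => (hE.volume_sampleBox_ne_top τ).lt_top)).ne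

/-- Boxes of distinct samples meet in null sets, so their volumes add up. -/
lemma IsShellPartition.volume_real_admissible (hE : IsShellPartition H Δω Etot E)
    (hH : Measurable H) (hnull : ∀ c, volume {x | H x = c} = 0) (hΔ : 0 < Δω) (L : ℕ) :
    volume.real (admissible L H Etot E) =
      Δω ^ L * totalWeight (relVolume H Δω E) (shellEnergy H E) L Etot := by
  rw [admissible_eq_biUnion, measureReal_biUnion_finset₀
    ((hE.aedisjoint_sampleBox hnull L).set_pairwise _)
    (fun τ _ => (measurableSet_sampleBox hH τ).nullMeasurableSet)
    (fun τ _ => hE.volume_sampleBox_ne_top τ), totalWeight, Finset.mul_sum, Finset.sum_filter]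
  refine Finset.sum_congr rfl fun τ _ => ?_
  rw [sampleWeight, mul_ite, mul_zero, volume_real_sampleBox hΔ]

/-- Closed shells share boundary levels, so a point may belong to two of them. Off a null set it
does not, and counting points in a shell is the same as counting its occurrences in the sample. -/
lemma IsShellPartition.ae_shell_unique (hE : IsShellPartition H Δω Etot E)
    (hnull : ∀ c, volume {x | H x = c} = 0) (L : ℕ) :
    ∀ᵐ ξ : Fin L → PhaseSpace N, ∀ i j k, ξ i ∈ shell H E j → ξ i ∈ shell H E k → j = k := by
  have h1 : ∀ᵐ x : PhaseSpace N, ∀ j k, x ∈ shell H E j → x ∈ shell H E k → j = k := by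
    rw [ae_all_iff]
    intro j
    rw [ae_all_iff]
    intro k
    by_cases hjk : j = k
    · exact Eventually.of_forall fun _ _ _ => hjk
    · have h0 : volume (shell H E j ∩ shell H E k) = 0 := hE.aedisjoint hnull hjk
      filter_upwards [measure_eq_zero_iff_ae_notMem.1 h0] with x hx hj hk
      exact absurd ⟨hj, hk⟩ hx
  rw [ae_all_iff]
  intro i
  exact (Measure.quasiMeasurePreserving_eval
    (fun _ : Fin L => (volume : Measure (PhaseSpace N))) i).ae h1

lemma IsShellPartition.volume_real_count_le (hE : IsShellPartition H Δω Etot E)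
    (hnull : ∀ c, volume {x | H x = c} = 0) (hΔ : 0 < Δω) (L K : ℕ)
    (l : Fin s) :
    volume.real (admissible L H Etot E ∩ {ξ | K ≤ {i : Fin L | ξ i ∈ shell H E l}.ncard}) ≤
      Δω ^ L * ∑ τ : Fin L → Fin s with K ≤ #{i | τ i = l},
        sampleWeight (relVolume H Δω E) (shellEnergy H E) Etot τ := by
  set T := Finset.univ.filter (fun τ : Fin L → Fin s =>
    K ≤ #{i | τ i = l} ∧ ∑ i, shellEnergy H E (τ i) ≤ Etot) with hT
  have hfin : volume (⋃ τ ∈ T, sampleBox H E τ) ≠ ∞ :=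
    ((measure_biUnion_finset_le _ _).trans_lt
      (ENNReal.sum_lt_top.2 fun τ _ => (hE.volume_sampleBox_ne_top τ).lt_top)).ne
  have hsub : (admissible L H Etot E ∩ {ξ | K ≤ {i : Fin L | ξ i ∈ shell H E l}.ncard} :
      Set (Fin L → PhaseSpace N)) ≤ᵐ[volume] ⋃ τ ∈ T, sampleBox H E τ := by
    filter_upwards [hE.ae_shell_unique hnull L] with ξ huniq
    rintro ⟨⟨τ, hτ, hsum⟩, hK⟩
    refine Set.mem_biUnion (x := τ) ?_ (fun i _ => hτ i)
    have heq : {i : Fin L | ξ i ∈ shell H E l} =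
        ((Finset.univ.filter fun i => τ i = l : Finset (Fin L)) : Set (Fin L)) := by
      ext i
      simp only [Set.mem_ofPred_eq, Finset.coe_filter, Finset.mem_univ, true_and]
      exact ⟨fun h => huniq i _ _ (hτ i) h, fun h => h ▸ hτ i⟩
    have hK' : K ≤ {i : Fin L | ξ i ∈ shell H E l}.ncard := hK
    rw [heq, Set.ncard_coe_finset] at hK'
    simpa [hT] using ⟨hK', hsum⟩
  calc _ ≤ volume.real (⋃ τ ∈ T, sampleBox H E τ) :=
        ENNReal.toReal_mono hfin (measure_mono_ae hsub)
    _ ≤ ∑ τ ∈ T, volume.real (sampleBox H E τ) := measureReal_biUnion_finset_le _ _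
    _ = _ := by
        rw [Finset.mul_sum, hT, ← Finset.filter_filter, Finset.sum_filter]
        refine Finset.sum_congr rfl fun τ _ => ?_
        rw [sampleWeight, mul_ite, mul_zero, volume_real_sampleBox hΔ]

end PhaseVolume

/-- Write the product as `(2 * C) ^ K / K!` times `K ^ p / 2 ^ K`; both tend to zero. -/
lemma eventually_pow_div_factorial_le (C : ℝ) (p : ℕ) :
    ∀ᶠ K : ℕ in atTop, C ^ K / K.factorial * (K : ℝ) ^ p ≤ 1 := by
  have h1 := FloorSemiring.tendsto_pow_div_factorial_atTop (2 * C)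
  have h2 := tendsto_pow_const_div_const_pow_of_one_lt p (one_lt_two (α := ℝ))
  have h3 := h1.mul h2
  rw [zero_mul] at h3
  filter_upwards [h3.eventually (ge_mem_nhds one_pos)] with K hK
  refine le_trans (le_of_eq ?_) hK
  rw [mul_pow]
  field_simp

/-- The three parts serve to make the deviation exceed any Gibbs value, to trade powers of `L` for
powers of `K`, and to leave at least `K` coordinates after removing `K`. -/
lemma eventually_sqrt_mul_log :
    ∀ᶠ L : ℕ in atTop, 1 < √(L * Real.log L) ∧
      L ≤ ⌈√(L * Real.log L)⌉₊ ^ 2 ∧ 2 * ⌈√(L * Real.log L)⌉₊ ≤ L := by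
  have hlog : ∀ᶠ x : ℝ in atTop, ‖Real.log x‖ ≤ 1 / 16 * ‖x‖ :=
    Real.isLittleO_log_id_atTop.def (by norm_num)
  filter_upwards [tendsto_natCast_atTop_atTop.eventually hlog, eventually_ge_atTop 4]
    with L hL hL4
  have hL4' : (4 : ℝ) ≤ L := by exact_mod_cast hL4
  have hlog1 : 1 ≤ Real.log L := by
    rw [Real.le_log_iff_exp_le (by linarith)]
    linarith [Real.exp_one_lt_d9]
  rw [Real.norm_of_nonneg (by linarith), Real.norm_of_nonneg (by linarith)] at hL
  have hsq : (L : ℝ) ≤ L * Real.log L := by nlinarith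
  have hceil := Nat.le_ceil (√(L * Real.log L))
  have hub : √(L * Real.log L) ≤ L / 4 := by
    rw [Real.sqrt_le_left (by linarith)]
    nlinarith
  have hs0 := Real.sqrt_nonneg (L * Real.log L)
  refine ⟨?_, ?_, ?_⟩
  · rw [Real.lt_sqrt (by norm_num)]
    linarith
  · have : (L : ℝ) ≤ (⌈√(L * Real.log L)⌉₊ : ℝ) ^ 2 := by
      calc (L : ℝ) ≤ L * Real.log L := hsq
        _ = √(L * Real.log L) ^ 2 := (Real.sq_sqrt (by linarith)).symm
        _ ≤ _ := by gcongr
    exact_mod_cast this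
  · have := Nat.ceil_lt_add_one hs0
    have : 2 * (⌈√(L * Real.log L)⌉₊ : ℝ) < L + 1 := by linarith
    have h2 : 2 * ⌈√(L * Real.log L)⌉₊ < L + 1 := by exact_mod_cast this
    omega

/-! ### Choice of constants and the tail bound -/

section Concentration

variable {N : ℕ} {H : PhaseSpace N → ℝ} {b : ℝ}

/-- For large `L`, the admissible samples visiting some shell `K` times have a small share of the
phase volume. -/
lemma exists_volume_real_count_le (hH : Measurable H) (hH0 : ∀ x, 0 ≤ H x)
    (hnull : ∀ c, volume {x | H x = c} = 0) (hb : 0 < b)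
    (hZ : Integrable (fun x => Real.exp (-b * H x)))
    (hHZ : Integrable (fun x => H x * Real.exp (-b * H x))) :
    ∃ (C : ℝ) (L₀ : ℕ), ∀ L : ℕ, L₀ ≤ L → ∀ Δω : ℝ, 0 < Δω →
      1 / Δω * ∫ x, Real.exp (-b * H x) = L →
      ∀ Etot : ℝ, Etot = 1 / Δω * ∫ x, H x * Real.exp (-b * H x) →
      ∀ (s : ℕ) (E : Fin (s + 1) → ℝ), IsShellPartition H Δω Etot E →
        0 < volume.real (admissible L H Etot E) ∧
        ∀ (l : Fin s) (K : ℕ), 2 * K ≤ L →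
          volume.real
            (admissible L H Etot E ∩ {ξ | K ≤ {i : Fin L | ξ i ∈ shell H E l}.ncard}) ≤
          C ^ K / K.factorial * volume.real (admissible L H Etot E) := by
  set Z := ∫ x, Real.exp (-b * H x) with hZdef
  have hZ0 : 0 < Z := integral_exp_pos hZ
  set W := ∫ x, H x * Real.exp (-b * H x) with hW
  set h := W / Z with hh
  have hfin := fun c => measure_sublevel_lt_top hb hZ c
  have hVh : 0 < volume {x | H x ≤ h} :=
    measure_sublevel_mean_pos hZ hHZ (div_mul_cancel₀ W hZ0.ne')
  set V : ℝ → ℝ := fun c => volume.real {x | H x ≤ c} with hV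
  have hVh' : 0 < V h := ENNReal.toReal_pos hVh.ne' (hfin h).ne
  -- The factor `2` here and in `c` absorbs the `Δω` lost in passing from sublevel sets to shells;
  -- in the bound `Z / (2 * z ^ 2)` for the volume below `h'` it absorbs the one gained.
  set c' := V h / (2 * Z) with hc'def
  have hc' : 0 < c' := by positivity
  set z := max 1 (2 * Real.exp (4 * b * h) / c') with hz
  have hz1 : 1 ≤ z := le_max_left _ _
  have hzD : 2 * Real.exp (4 * b * h) ≤ c' * z := by
    rw [← div_le_iff₀' hc']
    exact le_max_right _ _
  obtain ⟨h₁, h', h₁0, h₁h', h'h, hV₁, hV'⟩ := exists_sublevel_small hH hH0 hnull hfin hVh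
    (η := Z / (2 * z ^ 2)) (by positivity)
  set c := V h₁ / (2 * Z) with hcdef
  have hc : 0 < c := div_pos hV₁ (by positivity)
  have hδ : 0 < h' - h₁ := by linarith
  set q := ⌈h₁ / (h' - h₁)⌉₊ with hq
  have hq1 : h₁ ≤ q * (h' - h₁) := by
    rw [← div_le_iff₀ hδ]
    exact Nat.le_ceil _
  -- Rounding up overshoots `h₁` by less than one step, hence ends at most at `h' ≤ h`.
  have hq2 : q * (h' - h₁) ≤ h := by
    have : (q : ℝ) < h₁ / (h' - h₁) + 1 := Nat.ceil_lt_add_one (by positivity)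
    have h2 : (q : ℝ) * (h' - h₁) ≤ (h₁ / (h' - h₁) + 1) * (h' - h₁) := by gcongr
    have h3 : (h₁ / (h' - h₁) + 1) * (h' - h₁) = h' := by field_simp; ring
    linarith
  -- Since `Δω = Z / L`, the bound `L ≥ 1 / c` gives `Δω ≤ V h₁ / 2`, and `L ≥ 2 * z ^ 2` gives `Δω
  -- ≤ Z / (2 * z ^ 2)`.
  refine ⟨(4 * Real.exp (16 * b * h) / c + 1) ^ q / c,
    max 1 (max ⌈1 / c⌉₊ ⌈2 * z ^ 2⌉₊), ?_⟩
  intro L hL Δω hΔ hLZ Etot hEtot s E hE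
  have hL1 : 1 ≤ L := (le_max_left _ _).trans hL
  have hL1' : (1 : ℝ) ≤ L := by exact_mod_cast hL1
  have hLc : 1 / c ≤ L := (Nat.le_ceil _).trans
    (by exact_mod_cast (le_max_left _ _).trans ((le_max_right _ _).trans hL))
  have hLz : 2 * z ^ 2 ≤ L := (Nat.le_ceil _).trans
    (by exact_mod_cast (le_max_right _ _).trans ((le_max_right _ _).trans hL))
  have hZL : Z = L * Δω := by rw [← hLZ]; field_simp
  have hEL : Etot = L * h := by rw [hEtot, hh, ← hLZ]; field_simp
  have hh0 : 0 ≤ h := by linarith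
  have hhE : h ≤ Etot := by rw [hEL]; nlinarith
  set w := relVolume H Δω E with hw
  set ε := shellEnergy H E with hε
  have hw0 : ∀ j, 0 ≤ w j := fun j => div_nonneg measureReal_nonneg hΔ.le
  have hw1 : ∀ j, w j ≤ 1 := fun j => (div_le_one hΔ).2 (hE.volume_real_le hΔ.le j)
  have hε0 : ∀ j, 0 ≤ ε j := fun j => hE.shellEnergy_nonneg hH j
  have hf : ∑ j, w j * Real.exp (-b * ε j) ≤ L := by
    have h1 := hE.sum_volume_mul_exp_le hH hnull hZ
    rw [← hLZ, one_div_mul_eq_div, le_div_iff₀ hΔ, Finset.sum_mul]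
    refine le_trans (le_of_eq (Finset.sum_congr rfl fun j _ => ?_)) h1
    simp only [hw, relVolume, hε]
    field_simp
  have hsum : ∀ x, ∑ j with ε j ≤ x, w j =
      (∑ j with ε j ≤ x, volume.real (shell H E j)) / Δω := fun x => by
    rw [Finset.sum_div]
    rfl
  have hlower : ∀ x ≤ h, c ≤ V x / (2 * Z) →
      V x / (2 * Z) * L ≤ ∑ j with ε j ≤ x, w j := by
    intro x hx hcx
    have h1 := hE.le_sum_volume hΔ.le hH hH0 hnull (hx.trans hhE)
    rw [hsum, le_div_iff₀ hΔ]
    have h2 : 1 ≤ V x / (2 * Z) * L := by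
      calc (1 : ℝ) = c * (1 / c) := by field_simp
        _ ≤ _ := by gcongr
    have h3 : V x / (2 * Z) * L * Δω = V x / 2 := by
      rw [mul_assoc, ← hZL]
      field_simp
    have h4 : Δω ≤ V x / 2 := by
      rw [← h3]
      nlinarith
    rw [h3]
    have h5 : V x ≤ ∑ j with ε j ≤ x, volume.real (shell H E j) + Δω := h1
    linarith
  have hVmono : V h₁ ≤ V h := measureReal_mono
    (fun x hx => le_trans (show H x ≤ h₁ from hx) (by linarith)) (hfin h).ne
  have hlow := hlower h₁ (by linarith) le_rfl
  have hmean := hlower h le_rfl (by rw [hcdef]; gcongr)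
  have hlow' : ∑ j with ε j ≤ h', w j ≤ L / z ^ 2 := by
    have h1 := hE.sum_volume_le hΔ.le hH hnull (hfin h')
    rw [hsum, div_le_iff₀ hΔ]
    have hz2 : 0 < z ^ 2 := by positivity
    have h2 : Z / (2 * z ^ 2) = L / z ^ 2 * Δω / 2 := by
      rw [hZL]
      field_simp
    have h3 : Δω ≤ L / z ^ 2 * Δω / 2 := by
      have : 2 ≤ L / z ^ 2 := by rwa [le_div_iff₀ hz2]
      nlinarith
    linarith
  have hvol := hE.volume_real_admissible hH hnull hΔ L
  refine ⟨?_, ?_⟩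
  · rw [hvol]
    have := pow_le_totalWeight (ε := ε) hw0 (by positivity) hmean L (X := Etot) hEL.ge
    have h2 : 0 < (V h / (2 * Z) * L) ^ L := by positivity
    exact mul_pos (pow_pos hΔ L) (h2.trans_le this)
  · intro l K hK
    refine (hE.volume_real_count_le hnull hΔ L K l).trans ?_
    rw [hvol, mul_left_comm]
    refine mul_le_mul_of_nonneg_left ?_ (by positivity)
    obtain ⟨n, rfl⟩ : ∃ n, L = n + K := ⟨L - K, by omega⟩
    rw [hEL]
    exact sum_sampleWeight_card_ge_le hw0 hw1 hε0 hb.le hc hc' hz1 h₁0 h₁h' h'h (by omega)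
      (by omega) hq1 hq2 hf hlow hlow' hmean hzD l

/-- Occupation numbers of shells can deviate from their Gibbs values only upwards, since the latter
are at most one. -/
lemma IsShellPartition.le_ncard_of_le_abs {s L : ℕ} {Δω Etot : ℝ} {E : Fin (s + 1) → ℝ}
    (hE : IsShellPartition H Δω Etot E) (hb : 0 ≤ b) (hΔ : 0 < Δω)
    (hL : 0 < L) {t : ℝ} (ht : 1 < t) {l : Fin s} {ξ : Fin L → PhaseSpace N}
    (hξ : t ≤ |L * shellDensity H E l ξ -
      1 / Δω * ∫ x in shell H E l, Real.exp (-b * H x)|) :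
    t ≤ ({i : Fin L | ξ i ∈ shell H E l}.ncard : ℝ) := by
  have hI0 : 0 ≤ 1 / Δω * ∫ x in shell H E l, Real.exp (-b * H x) :=
    mul_nonneg (by positivity) (integral_nonneg fun x => Real.exp_nonneg _)
  have hI1 : 1 / Δω * ∫ x in shell H E l, Real.exp (-b * H x) ≤ 1 := by
    rw [one_div_mul_eq_div, div_le_one hΔ]
    refine le_trans ?_ (hE.volume_real_le hΔ.le l)
    refine le_trans (le_abs_self _) ?_
    rw [← Real.norm_eq_abs, ← one_mul (volume.real _)]
    refine norm_setIntegral_le_of_norm_le_const (hE.volume_lt_top l) fun x hx => ?_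
    rw [Real.norm_of_nonneg (Real.exp_nonneg _), Real.exp_le_one_iff]
    nlinarith [(hE.nonneg _).trans hx.1]
  have hdens : L * shellDensity H E l ξ = ({i : Fin L | ξ i ∈ shell H E l}.ncard : ℝ) := by
    rw [shellDensity]
    field_simp
  rw [hdens] at hξ
  have hn0 : (0 : ℝ) ≤ ({i : Fin L | ξ i ∈ shell H E l}.ncard : ℝ) := Nat.cast_nonneg _
  rcases le_abs.1 hξ with h | h <;> linarith

end Concentration

end GibbsShells

theorem theorem1 (N : ℕ) (hN : 1 ≤ N) (mass : ℝ) (hmass : 0 < mass)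
    (U : EuclideanSpace ℝ (Fin (3 * N)) → ℝ) (hU : Measurable U) (hU0 : ∀ q, 0 ≤ U q)
    (H : GibbsShells.PhaseSpace N → ℝ) (hH : H = GibbsShells.hamiltonian mass U)
    (b : ℝ) (hb : 0 < b)
    (hZ : Integrable (fun x => Real.exp (-b * H x)))
    (hHZ : Integrable (fun x => H x * Real.exp (-b * H x)))
    (m : ℤ) :
    ∃ L₀ : ℕ, ∀ L : ℕ, L₀ ≤ L → ∀ Δω : ℝ, 0 < Δω →
      1 / Δω * ∫ x, Real.exp (-b * H x) = L →
      ∀ Etot : ℝ, Etot = 1 / Δω * ∫ x, H x * Real.exp (-b * H x) →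
      ∀ (s : ℕ) (E : Fin (s + 1) → ℝ), GibbsShells.IsShellPartition H Δω Etot E →
        IsProbabilityMeasure (GibbsShells.phaseProb L H Etot E) ∧
        ∀ l : Fin s,
          (GibbsShells.phaseProb L H Etot E).real
            {ξ | Real.sqrt (L * Real.log L) ≤
              |L * GibbsShells.shellDensity H E l ξ
                - 1 / Δω * ∫ x in GibbsShells.shell H E l, Real.exp (-b * H x)|}
            ≤ (L : ℝ) ^ (-m) := by
  have hHm : Measurable H := hH ▸ GibbsShells.measurable_hamiltonian mass hU
  have hH0 : ∀ x, 0 ≤ H x := fun x => hH ▸ GibbsShells.hamiltonian_nonneg hmass hU0 x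
  have hnull : ∀ c, volume {x | H x = c} = 0 :=
    fun c => hH ▸ GibbsShells.volume_hamiltonian_eq hN hmass hU c
  obtain ⟨C, L₁, hC⟩ := GibbsShells.exists_volume_real_count_le hHm hH0 hnull hb hZ hHZ
  -- The exponent is doubled because only `L ≤ K ^ 2` is available. For negative `m` the exponent is
  -- `0`, which suffices as then `L ^ (-m) ≥ 1`.
  obtain ⟨K₀, hK₀⟩ := Filter.eventually_atTop.1
    (GibbsShells.eventually_pow_div_factorial_le C (2 * m.toNat))
  obtain ⟨L₂, hL₂⟩ := Filter.eventually_atTop.1 GibbsShells.eventually_sqrt_mul_log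
  refine ⟨max (max L₁ L₂) (max 1 (K₀ ^ 2)), ?_⟩
  intro L hL Δω hΔ hLZ Etot hEtot s E hE
  obtain ⟨hpos, hcount⟩ := hC L ((le_max_left _ _).trans ((le_max_left _ _).trans hL)) Δω hΔ hLZ
    Etot hEtot s E hE
  obtain ⟨hs1, hLK, hKL⟩ := hL₂ L ((le_max_right _ _).trans ((le_max_left _ _).trans hL))
  have hL1 : 1 ≤ L := (le_max_left _ _).trans ((le_max_right _ _).trans hL)
  have hK₀L : K₀ ^ 2 ≤ L := (le_max_right _ _).trans ((le_max_right _ _).trans hL)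
  -- An occupation number is an integer, so reaching the square root means reaching its ceiling.
  set K := ⌈√(L * Real.log L)⌉₊ with hK
  have hK₀K : K₀ ≤ K := (Nat.pow_le_pow_iff_left two_ne_zero).1 (hK₀L.trans hLK)
  have hfac := hK₀ K hK₀K
  have hfin := hE.volume_admissible_ne_top L
  have hne : volume (GibbsShells.admissible L H Etot E) ≠ 0 := by
    intro h0
    rw [measureReal_def, h0, ENNReal.toReal_zero] at hpos
    exact lt_irrefl _ hpos
  refine ⟨ProbabilityTheory.cond_isProbabilityMeasure_of_finite hne hfin, fun l => ?_⟩
  have hL0 : (0 : ℝ) < L := by exact_mod_cast hL1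
  rw [measureReal_def, GibbsShells.phaseProb, ProbabilityTheory.cond_apply
    (GibbsShells.measurableSet_admissible hHm L), ENNReal.toReal_mul, ENNReal.toReal_inv]
  change (volume.real _)⁻¹ * volume.real _ ≤ _
  rw [inv_mul_le_iff₀ hpos]
  calc _ ≤ volume.real (GibbsShells.admissible L H Etot E ∩
          {ξ | K ≤ {i : Fin L | ξ i ∈ GibbsShells.shell H E l}.ncard}) := by
        refine measureReal_mono (Set.inter_subset_inter_right _ fun ξ hξ => ?_)
          (measure_ne_top_of_subset Set.inter_subset_left hfin)
        exact Nat.ceil_le.2 (hE.le_ncard_of_le_abs hb.le hΔ hL1 hs1 hξ)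
    _ ≤ _ := hcount l K hKL
    _ ≤ (L : ℝ) ^ (-m) * volume.real (GibbsShells.admissible L H Etot E) := by
        gcongr
        have hLK' : (L : ℝ) ≤ (K : ℝ) ^ 2 := by exact_mod_cast hLK
        have hLm : (L : ℝ) ^ m.toNat ≤ (K : ℝ) ^ (2 * m.toNat) := by
          rw [pow_mul]
          gcongr
        have hLm0 : (0 : ℝ) < (L : ℝ) ^ m.toNat := by positivity
        calc C ^ K / K.factorial ≤ 1 / (K : ℝ) ^ (2 * m.toNat) := by
              rwa [le_div_iff₀ (hLm0.trans_le hLm)]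
          _ ≤ 1 / (L : ℝ) ^ m.toNat := by gcongr
          _ = (L : ℝ) ^ (-(m.toNat : ℤ)) := by rw [zpow_neg, zpow_natCast, one_div]
          _ ≤ (L : ℝ) ^ (-m) := by
              apply zpow_le_zpow_right₀ (by exact_mod_cast hL1)
              have := Int.self_le_toNat m
              omega
    _ = _ := mul_comm _ _
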